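/- Let $p$ be a prime and let $V$ be a Henselian valuation ring of characteristic $p$ (that is, $V\supset\mathbf F_p$), so that its residue field also has characteristic $p$. Then there is a countable sequence of ultrafilters $\mathscr U_1,\mathscr U_2,\dots$ on some respective sets $U_1,U_2,\dots$ such that, for the valuation rings $\{V_n\}_{n\ge 0}$ defined inductively by $V_0:=V$ and $V_{n+1}:=\prod_{\mathscr U_{n+1}}V_n$ (the ultrapower of $V_n$) for $n\ge 0$, and for the valuation ring $\widetilde V:=\varinjlim_{n\ge 0}V_n$, the direct limit along the diagonal embeddings $V_n\to V_{n+1}$, there exists a lifting $\widetilde t:\widetilde k\to\widetilde V$ of the residue field $\widetilde k$ of $\widetilde V$, that is, a ring homomorphism whose composite with the residue map $\widetilde V\to\widetilde k$ is the identity of $\widetilde k$. -/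

import Mathlib

universe u

namespace UltraTower

/-- The diagonal ring homomorphism from a ring `A` to its ultrapower `∏_𝒰 A`. Mathlib's
`Filter.Germ (𝒰 : Filter I) A` is the ultrapower: functions `I → A` modulo equality on a set
belonging to `𝒰`, with pointwise operations. -/
def diag {I : Type u} (𝒰 : Ultrafilter I) (A : Type u) [CommRing A] :
    A →+* (𝒰 : Filter I).Germ A :=
  (Filter.Germ.coeRingHom (𝒰 : Filter I)).comp (Pi.constRingHom I A)

section Ultrapower

variable {I : Type u} (𝒰 : Ultrafilter I) (A : Type u) [CommRing A] [IsDomain A]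

/-- An ultrapower of a domain is a domain. -/
theorem isDomain_ultrapower : IsDomain ((𝒰 : Filter I).Germ A) := by
  have : NoZeroDivisors ((𝒰 : Filter I).Germ A) := by
    refine ⟨fun {a b} => Filter.Germ.inductionOn₂ a b fun f g h => ?_⟩
    have h' : ∀ᶠ x in (𝒰 : Filter I), f x = 0 ∨ g x = 0 :=
      (Filter.Germ.coe_eq.1 h).mono fun x hx => mul_eq_zero.1 hx
    exact (Ultrafilter.eventually_or.1 h').imp
      (fun h => Filter.Germ.coe_eq.2 h) (fun h => Filter.Germ.coe_eq.2 h)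
  exact NoZeroDivisors.to_isDomain _

/-- An ultrapower of a valuation ring satisfies the divisibility condition of valuation rings. -/
theorem preValuationRing_ultrapower [ValuationRing A] :
    PreValuationRing ((𝒰 : Filter I).Germ A) := by
  refine ⟨fun a b => Filter.Germ.inductionOn₂ a b fun f g => ?_⟩
  choose c hc using fun x => ValuationRing.cond (f x) (g x)
  refine ⟨(c : (𝒰 : Filter I).Germ A), ?_⟩
  have h : ∀ᶠ x in (𝒰 : Filter I), f x * c x = g x ∨ g x * c x = f x :=
    Filter.Eventually.of_forall hc
  exact (Ultrafilter.eventually_or.1 h).imp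
    (fun h => Filter.Germ.coe_eq.2 h) (fun h => Filter.Germ.coe_eq.2 h)

end Ultrapower

end UltraTower

/-- The tower of iterated ultrapowers `V_0 = V`, `V_{n+1} = ∏_{𝒰 n} V_n` of `V` along a sequence of
ultrafilters. The sequence is numbered from `0`, so `𝒰 n` is the ultrafilter used to pass from
`V_n` to `V_{n+1}`. -/
def UltraTower (V : Type u) {U : ℕ → Type u} (𝒰 : ∀ n, Ultrafilter (U n)) : ℕ → Type u
  | 0 => V
  | n + 1 => (𝒰 n : Filter (U n)).Germ (UltraTower V 𝒰 n)

namespace UltraTower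

variable (V : Type u) [CommRing V] {U : ℕ → Type u} (𝒰 : ∀ n, Ultrafilter (U n))

/-- The ring structure of the stages of the tower: that of `V`, then the pointwise one on each
ultrapower. -/
instance instCommRing : ∀ n, CommRing (UltraTower V 𝒰 n)
  | 0 => inferInstanceAs (CommRing V)
  | n + 1 =>
    letI := instCommRing n
    inferInstanceAs (CommRing ((𝒰 n : Filter (U n)).Germ (UltraTower V 𝒰 n)))

/-- The diagonal embedding `V_n → V_{n+1}`. -/
def succMap (n : ℕ) : UltraTower V 𝒰 n →+* UltraTower V 𝒰 (n + 1) :=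
  diag (𝒰 n) (UltraTower V 𝒰 n)

/-- The transition homomorphism `V_m → V_n` for `m ≤ n`: the composite of the diagonal
embeddings. -/
def map (m n : ℕ) (h : m ≤ n) : UltraTower V 𝒰 m →+* UltraTower V 𝒰 n :=
  Nat.leRecOn h (fun {k} g => (succMap V 𝒰 k).comp g) (RingHom.id _)

theorem map_self (m : ℕ) : map V 𝒰 m m le_rfl = RingHom.id _ :=
  Nat.leRecOn_self _

theorem map_succ (m n : ℕ) (h : m ≤ n) :
    map V 𝒰 m (n + 1) (h.trans n.le_succ) = (succMap V 𝒰 n).comp (map V 𝒰 m n h) :=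
  Nat.leRecOn_succ h _

instance directedSystem : DirectedSystem (UltraTower V 𝒰) (map V 𝒰 · · ·) where
  map_self i x := by rw [map_self, RingHom.id_apply]
  map_map k j i hij hjk x := by
    induction hjk with
    | refl => rw [map_self, RingHom.id_apply]
    | step h ih =>
      rw [map_succ V 𝒰 _ _ h, map_succ V 𝒰 _ _ (hij.trans h), RingHom.comp_apply,
        RingHom.comp_apply, ih]

/-- The direct limit `Ṽ = lim_n V_n` of the tower along the diagonal embeddings. -/
abbrev Limit : Type u := DirectLimit (UltraTower V 𝒰) (map V 𝒰)

instance isDomain [IsDomain V] : ∀ n, IsDomain (UltraTower V 𝒰 n)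
  | 0 => inferInstanceAs (IsDomain V)
  | n + 1 =>
    haveI := isDomain n
    isDomain_ultrapower (𝒰 n) (UltraTower V 𝒰 n)

/-- All stages of the tower over a valuation ring are valuation rings. -/
instance valuationRing [IsDomain V] [ValuationRing V] : ∀ n, ValuationRing (UltraTower V 𝒰 n)
  | 0 => inferInstanceAs (ValuationRing V)
  | n + 1 =>
    haveI := valuationRing n
    { cond' := (preValuationRing_ultrapower (𝒰 n) (UltraTower V 𝒰 n)).cond' }

instance limit_isDomain [IsDomain V] : IsDomain (Limit V 𝒰) := by
  have : NoZeroDivisors (Limit V 𝒰) := by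
    refine ⟨fun {a b} h => ?_⟩
    obtain ⟨i, x, y, rfl, rfl⟩ := DirectLimit.exists_eq_mk₂ _ a b
    rw [DirectLimit.mul_def, DirectLimit.zero_def i] at h
    obtain ⟨j, hj, hj', e⟩ := Quotient.exact h
    change map V 𝒰 i j hj (x * y) = map V 𝒰 i j hj' 0 at e
    rw [map_mul, map_zero] at e
    have key : ∀ z : UltraTower V 𝒰 i, map V 𝒰 i j hj z = 0 →
        (⟦⟨i, z⟩⟧ : Limit V 𝒰) = 0 := fun z hz => by
      rw [← DirectLimit.mk_apply (f := map V 𝒰) i j z hj, hz, DirectLimit.zero_def j]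
    exact (mul_eq_zero.1 e).imp (key x) (key y)
  exact NoZeroDivisors.to_isDomain _

/-- The direct limit of the tower over a valuation ring is a valuation ring (in particular a local
ring). -/
instance limit_valuationRing [IsDomain V] [ValuationRing V] : ValuationRing (Limit V 𝒰) where
  cond' a b := by
    obtain ⟨i, x, y, rfl, rfl⟩ := DirectLimit.exists_eq_mk₂ _ a b
    obtain ⟨c, hc⟩ := ValuationRing.cond x y
    refine ⟨⟦⟨i, c⟩⟧, hc.imp (fun h => ?_) (fun h => ?_)⟩ <;>
    rw [DirectLimit.mul_def, h]

end UltraTower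

/-- A lifting of the residue field of a local ring `R`: a ring homomorphism from the residue field
to `R` which is a section of the residue map. -/
def IsResidueFieldLifting {R : Type u} [CommRing R] [IsLocalRing R]
    (t : IsLocalRing.ResidueField R →+* R) : Prop :=
  (IsLocalRing.residue R).comp t = RingHom.id (IsLocalRing.ResidueField R)

/-! Let `k_n` be the residue field of `V_n`. Over a Henselian local ring `A`, a map `K → A` extends
to any finitely generated separable subextension of the residue field: a separating transcendence
basis is lifted arbitrarily, and Hensel's lemma lifts a primitive element of what remains. These
partial liftings need not agree with each other, but an ultrafilter finer than `atTop` on finite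
subsets glues them into a lifting of the whole residue field with values in the ultrapower of `A`
(`exists_lift_ultrapower`).

To repeat this along the tower, `k_{n+1}` must be separable over `k_n`. It is, being an ultrapower
of `k_n` (`macLaneSeparable_residueField_map_diag`). Starting from the prime field, over which
separability is automatic, one gets maps `t_n : k_n → V_{n+1}`, each extending the one before; in
the limit the shift by one disappears. -/

namespace UltraTower

/-! ### Ultrapowers of local and Henselian rings -/

section Germ

variable {I : Type u} {𝒰 : Ultrafilter I} {A : Type u} [CommRing A]

theorem isUnit_germ_iff (f : I → A) :
    IsUnit (f : (𝒰 : Filter I).Germ A) ↔ ∀ᶠ i in (𝒰 : Filter I), IsUnit (f i) := by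
  refine ⟨fun h => ?_, fun h => ?_⟩
  · obtain ⟨b, hb⟩ := h.exists_right_inv
    induction b using Filter.Germ.inductionOn with
    | _ g => exact (Filter.Germ.coe_eq.1 hb).mono fun i hi => IsUnit.of_mul_eq_one _ hi
  · refine IsUnit.of_mul_eq_one ((fun i => Ring.inverse (f i) : I → A) : (𝒰 : Filter I).Germ A) ?_
    exact Filter.Germ.coe_eq.2 (h.mono fun i hi => Ring.mul_inverse_cancel _ hi)

theorem isLocalRing_germ [IsLocalRing A] : IsLocalRing ((𝒰 : Filter I).Germ A) := by
  refine IsLocalRing.of_isUnit_or_isUnit_one_sub_self fun a => ?_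
  induction a using Filter.Germ.inductionOn with
  | _ f =>
    refine (Ultrafilter.eventually_or.1 (Filter.Eventually.of_forall fun i =>
      IsLocalRing.isUnit_or_isUnit_one_sub_self (f i))).imp (isUnit_germ_iff f).2 fun h => ?_
    exact (isUnit_germ_iff (fun i => 1 - f i)).2 h

attribute [local instance] isLocalRing_germ

theorem isLocalHom_diag (𝒰 : Ultrafilter I) : IsLocalHom (diag 𝒰 A) :=
  ⟨fun a h => by
    obtain ⟨_, hi⟩ := ((isUnit_germ_iff (𝒰 := 𝒰) (fun _ => a)).1 h).exists
    exact hi⟩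

-- Hensel's lemma can be solved coordinate by coordinate: a monic polynomial over the ultrapower
-- comes from a monic one over `I → A`, and its hypotheses at an approximate root hold on a set of
-- the ultrafilter.
open Polynomial in
theorem henselianLocalRing_germ [HenselianLocalRing A] :
    HenselianLocalRing ((𝒰 : Filter I).Germ A) where
  is_henselian F hF a₀ h₀ h₁ := by
    let π := Filter.Germ.coeRingHom (R := A) (𝒰 : Filter I)
    have hπ : Function.Surjective π := fun x => by
      induction x using Filter.Germ.inductionOn with
      | _ f => exact ⟨f, rfl⟩
    obtain ⟨f, hfF, -, hf⟩ := lifts_and_natDegree_eq_and_monic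
      (show F ∈ lifts π from (mem_lifts F).2 (map_surjective π hπ F)) hF
    obtain ⟨a, rfl⟩ := hπ a₀
    subst hfF
    let f' (i : I) : A[X] := f.map (Pi.evalRingHom (fun _ => A) i)
    have ev (g : (I → A)[X]) (b : I → A) (i : I) :
        g.eval b i = (g.map (Pi.evalRingHom (fun _ => A) i)).eval (b i) :=
      (eval_map_apply (f := Pi.evalRingHom (fun _ => A) i) (p := g) b).symm
    rw [eval_map_apply, IsLocalRing.mem_maximalIdeal, mem_nonunits_iff] at h₀
    rw [derivative_map, eval_map_apply] at h₁
    have h₀' := Ultrafilter.eventually_not.2 (mt (isUnit_germ_iff (𝒰 := 𝒰) (f.eval a)).2 h₀)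
    have h₁' := (isUnit_germ_iff (𝒰 := 𝒰) (f.derivative.eval a)).1 h₁
    have key : ∀ᶠ i in (𝒰 : Filter I), ∃ b : A, (f' i).eval b = 0 ∧ ¬ IsUnit (b - a i) := by
      filter_upwards [h₀', h₁'] with i hi₀ hi₁
      rw [ev] at hi₀ hi₁
      rw [← derivative_map] at hi₁
      exact HenselianLocalRing.is_henselian (f' i) (hf.map _) (a i) hi₀ hi₁
    -- Outside the large set `key` the value of `b` is arbitrary; the germ does not see it.
    choose! b hb using fun i (h : ∃ b : A, (f' i).eval b = 0 ∧ ¬ IsUnit (b - a i)) => h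
    refine ⟨π b, ?_, ?_⟩
    · rw [IsRoot.def, eval_map_apply]
      refine Filter.Germ.coe_eq.2 (key.mono fun i hi => ?_)
      rw [ev]
      exact (hb i hi).1
    · rw [← map_sub, IsLocalRing.mem_maximalIdeal, mem_nonunits_iff]
      intro h
      obtain ⟨i, hi, hi'⟩ := (((isUnit_germ_iff (𝒰 := 𝒰) (b - a)).1 h).and key).exists
      exact (hb i hi').2 hi

end Germ

end UltraTower

/-! ### MacLane separability -/

/-- MacLane's criterion for a field extension `j : K → L` to be separable, at the exponent `p`:
elements of `L` whose `p`-th powers are linearly dependent over `K` are linearly dependent. -/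
def MacLaneSeparable (p : ℕ) {K L : Type*} [Field K] [Field L] (j : K →+* L) : Prop :=
  ∀ (n : ℕ) (x : Fin n → L), (∃ a : Fin n → K, a ≠ 0 ∧ ∑ i, j (a i) * x i ^ p = 0) →
    ∃ b : Fin n → K, b ≠ 0 ∧ ∑ i, j (b i) * x i = 0

/-- Frobenius fixes the prime field, so a relation among the `p`-th powers is the `p`-th power of
the relation with the same coefficients. -/
theorem MacLaneSeparable.of_zmod (p : ℕ) [Fact p.Prime] {L : Type*} [Field L] [CharP L p]
    (j : ZMod p →+* L) : MacLaneSeparable p j := by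
  rintro n x ⟨a, ha, h⟩
  refine ⟨a, ha, pow_eq_zero_iff (Fact.out : p.Prime).ne_zero |>.1 ?_⟩
  rw [← h, sum_pow_char]
  refine Finset.sum_congr rfl fun i _ => ?_
  rw [mul_pow, ← map_pow, ZMod.pow_card]

/-- The locus of vanishing of an additive form of degree `p` is a linear subspace. -/
def additiveFormLocus (p : ℕ) {K : Type*} [Field K] [CharP K p] [Fact p.Prime] {n : ℕ}
    (a : Fin n → K) : Submodule K (Fin n → K) where
  carrier := {y | ∑ i, a i * y i ^ p = 0}
  add_mem' {y z} hy hz := by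
    simp only [Set.mem_ofPred_eq, Pi.add_apply, add_pow_char, mul_add, Finset.sum_add_distrib] at *
    rw [hy, hz, add_zero]
  zero_mem' := by simp [(Fact.out : p.Prime).ne_zero]
  smul_mem' c y hy := by
    simp only [Set.mem_ofPred_eq, Pi.smul_apply, smul_eq_mul, mul_pow] at *
    simp only [mul_left_comm _ (c ^ p), ← Finset.mul_sum, hy, mul_zero]

/-- The zero locus is a subspace, and a proper one since a nonzero coefficient excludes a basis
vector; hence it lies in a hyperplane. The form `b` depends on `a` alone, which is what lets it pass
to ultrapowers. -/
theorem exists_linear_form_of_additiveForm (p : ℕ) {K : Type*} [Field K] [CharP K p]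
    [Fact p.Prime] {n : ℕ} {a : Fin n → K} (ha : a ≠ 0) :
    ∃ b : Fin n → K, b ≠ 0 ∧ ∀ y : Fin n → K, ∑ i, a i * y i ^ p = 0 → ∑ i, b i * y i = 0 := by
  have hlt : additiveFormLocus p a < ⊤ := by
    refine lt_top_iff_ne_top.2 fun h => ha (funext fun i => ?_)
    have hi : Pi.single i 1 ∈ additiveFormLocus p a := h ▸ Submodule.mem_top
    change ∑ l, a l * (Pi.single i 1 : Fin n → K) l ^ p = 0 at hi
    rw [Finset.sum_eq_single i (fun l _ hl => by
      rw [Pi.single_eq_of_ne hl, zero_pow (Fact.out : p.Prime).ne_zero, mul_zero])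
      (by simp)] at hi
    simpa using hi
  obtain ⟨φ, hφ, hle⟩ := Submodule.exists_le_ker_of_lt_top _ hlt
  have hφ' (y : Fin n → K) : φ y = ∑ i, φ (Pi.single i 1) * y i := by
    conv_lhs => rw [LinearMap.pi_apply_eq_sum_univ φ y]
    refine Finset.sum_congr rfl fun i _ => ?_
    rw [smul_eq_mul, mul_comm]
    congr 2
    ext l
    simp [Pi.single_apply, eq_comm]
  refine ⟨fun i => φ (Pi.single i 1), fun h => hφ (LinearMap.ext fun y => ?_), fun y hy => ?_⟩
  · rw [hφ']
    simp [fun i => congrFun h i]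
  · rw [← hφ']
    exact hle hy

/-! ### Separability of an ultrapower of the residue field -/

namespace UltraTower

open IsLocalRing

attribute [local instance] isLocalRing_germ isLocalHom_diag

variable {I : Type u} (𝒰 : Ultrafilter I) (A : Type u) [CommRing A] [IsLocalRing A]

/-- The residue class of the germ of a function `I → A`. -/
noncomputable def germResidue : (I → A) →+* ResidueField ((𝒰 : Filter I).Germ A) :=
  (residue _).comp (Filter.Germ.coeRingHom (𝒰 : Filter I))

variable {A} in
theorem germResidue_eq_zero_iff (f : I → A) :
    germResidue 𝒰 A f = 0 ↔ ∀ᶠ i in (𝒰 : Filter I), residue A (f i) = 0 := by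
  simp only [residue_eq_zero_iff, mem_maximalIdeal, mem_nonunits_iff]
  rw [Ultrafilter.eventually_not, ← isUnit_germ_iff]
  exact (residue_eq_zero_iff _)

theorem germResidue_surjective : Function.Surjective (germResidue 𝒰 A) := fun x => by
  obtain ⟨x, rfl⟩ := residue_surjective x
  induction x using Filter.Germ.inductionOn with
  | _ f => exact ⟨f, rfl⟩

/-- A relation among `p`-th powers holds in the residue field of `A` at almost every coordinate. The
single linear form `b` attached to its coefficients then vanishes at all those coordinates, hence on
the ultrapower. -/
theorem macLaneSeparable_residueField_map_diag (p : ℕ) [Fact p.Prime] [CharP (ResidueField A) p] :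
    MacLaneSeparable p (ResidueField.map (diag 𝒰 A)) := by
  rintro n x ⟨a, ha, h⟩
  obtain ⟨b, hb, hab⟩ := exists_linear_form_of_additiveForm p ha
  refine ⟨b, hb, ?_⟩
  choose f hf using fun i => germResidue_surjective 𝒰 A (x i)
  choose α hα using fun i => residue_surjective (a i)
  choose β hβ using fun i => residue_surjective (b i)
  have hmap (c : A) : ResidueField.map (diag 𝒰 A) (residue A c) =
    germResidue 𝒰 A (Pi.constRingHom I A c) := rfl
  simp only [← hf, ← hα, ← hβ, hmap, ← map_mul, ← map_sum, ← map_pow,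
    germResidue_eq_zero_iff] at h ⊢
  refine h.mono fun t ht => ?_
  have := hab (fun i => residue A (f i t))
  simp only [← hα, ← hβ] at this
  simpa using this (by simpa using ht)

end UltraTower

/-! ### Lifting separable extensions to Henselian rings -/

section Lifting

open IsLocalRing Polynomial

variable {A : Type*} [CommRing A]

/-- A lifting of a finite separable extension to a Henselian local ring. -/
theorem exists_lift_of_finite_separable [HenselianLocalRing A] {F L : Type*} [Field F] [Field L]
    [Algebra F L] [FiniteDimensional F L] [Algebra.IsSeparable F L]
    (ψ : F →+* A) (ι : L →+* ResidueField A) (h : (residue A).comp ψ = ι.comp (algebraMap F L)) :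
    ∃ φ : L →+* A, φ.comp (algebraMap F L) = ψ ∧ (residue A).comp φ = ι := by
  let pb := Field.powerBasisOfFiniteOfSeparable F L
  let f := minpoly F pb.gen
  have hroot : (f.map (algebraMap F L)).eval pb.gen = 0 := by
    rw [eval_map_algebraMap]; exact minpoly.aeval F pb.gen
  -- Separability makes the root simple, as Hensel's lemma requires.
  have hder : (f.derivative.map (algebraMap F L)).eval pb.gen ≠ 0 := by
    rw [eval_map_algebraMap]
    exact (Algebra.IsSeparable.isSeparable F pb.gen).aeval_derivative_ne_zero
      (minpoly.aeval F pb.gen)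
  obtain ⟨a₀, ha₀⟩ := residue_surjective (ι pb.gen)
  have red (g : F[X]) :
      residue A ((g.map ψ).eval a₀) = ι ((g.map (algebraMap F L)).eval pb.gen) := by
    rw [← eval_map_apply, ← eval_map_apply, map_map, map_map, h, ha₀]
  have h₀ : (f.map ψ).eval a₀ ∈ maximalIdeal A := by
    rw [← residue_eq_zero_iff, red, hroot, map_zero]
  have h₁ : IsUnit ((f.map ψ).derivative.eval a₀) := by
    rw [← residue_ne_zero_iff_isUnit, derivative_map, red]
    exact (map_ne_zero ι).2 hder
  obtain ⟨a, ha, haa₀⟩ := HenselianLocalRing.is_henselian (f.map ψ)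
    ((minpoly.monic (Algebra.IsIntegral.isIntegral pb.gen)).map ψ) a₀ h₀ h₁
  let : Algebra F A := ψ.toAlgebra
  -- With this structure both `ι` and the reduction of `φ` are `F`-algebra maps, so they can be
  -- compared on the generator alone.
  let : Algebra F (ResidueField A) := (ι.comp (algebraMap F L)).toAlgebra
  have haev : aeval a f = 0 := by
    rw [← eval_map_algebraMap]; exact ha
  let φ : L →ₐ[F] A := pb.lift a haev
  refine ⟨φ, RingHom.ext φ.commutes, ?_⟩
  let ι' : L →ₐ[F] ResidueField A := { ι with commutes' := fun _ => rfl }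
  let ρ : L →ₐ[F] ResidueField A :=
    { (residue A).comp φ.toRingHom with
      commutes' := fun x => by
        change residue A (φ (algebraMap F L x)) = ι (algebraMap F L x)
        rw [φ.commutes]
        exact RingHom.congr_fun h x }
  have : ρ = ι' := pb.algHom_ext (by
    change residue A (φ pb.gen) = ι pb.gen
    rw [pb.lift_gen, ← ha₀, ← sub_eq_zero, ← map_sub, residue_eq_zero_iff]
    exact haa₀)
  ext x
  exact DFunLike.congr_fun this x

open scoped IntermediateField.algebraAdjoinAdjoin in
/-- A lifting of a purely transcendental extension to a local ring. -/
theorem exists_lift_adjoin_of_algebraicIndependent [IsLocalRing A] {K L : Type*} [Field K]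
    [Field L] [Algebra K L] (ψ : K →+* A) (ι : L →+* ResidueField A)
    (h : (residue A).comp ψ = ι.comp (algebraMap K L)) {σ : Type*} {x : σ → L}
    (hx : AlgebraicIndependent K x) :
    ∃ φ : IntermediateField.adjoin K (Set.range x) →+* A, φ.comp (algebraMap K _) = ψ ∧
      (residue A).comp φ = ι.comp (algebraMap _ L) := by
  choose s hs using fun i => residue_surjective (ι (x i))
  have red (q : MvPolynomial σ K) :
      residue A (MvPolynomial.eval₂Hom ψ s q) = ι (MvPolynomial.aeval x q) := by
    suffices (residue A).comp (MvPolynomial.eval₂Hom ψ s) =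
      ι.comp (MvPolynomial.aeval x).toRingHom from RingHom.congr_fun this q
    refine MvPolynomial.ringHom_ext (fun c => ?_) fun i => ?_
    · simpa using RingHom.congr_fun h c
    · simpa using hs i
  let f : Algebra.adjoin K (Set.range x) →+* A :=
    (MvPolynomial.eval₂Hom ψ s).comp hx.repr.toRingHom
  have hf (y : Algebra.adjoin K (Set.range x)) : residue A (f y) = ι (y : L) :=
    (red _).trans (congrArg ι (hx.aeval_repr y))
  -- A nonzero polynomial expression in the `x i` has nonzero residue, hence is sent to a unit; so
  -- `f` extends to the fraction field.
  have hunit (y : nonZeroDivisors (Algebra.adjoin K (Set.range x))) : IsUnit (f y) := by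
    rw [← residue_ne_zero_iff_isUnit, hf, _root_.map_ne_zero]
    exact fun h0 => nonZeroDivisors.ne_zero y.2 (Subtype.ext h0)
  let φ : IntermediateField.adjoin K (Set.range x) →+* A := IsLocalization.lift hunit
  have hφ (y) : φ (algebraMap _ _ y) = f y := IsLocalization.lift_eq hunit y
  refine ⟨φ, RingHom.ext fun c => ?_, ?_⟩
  · rw [RingHom.comp_apply, IsScalarTower.algebraMap_apply K (Algebra.adjoin K (Set.range x)), hφ]
    change MvPolynomial.eval₂Hom ψ s (hx.repr (algebraMap K _ c)) = _
    rw [AlgHom.commutes]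
    exact MvPolynomial.eval₂Hom_C _ _ _
  · refine IsLocalization.ringHom_ext (nonZeroDivisors (Algebra.adjoin K (Set.range x)))
      (RingHom.ext fun y => ?_)
    simp only [RingHom.comp_apply]
    rw [hφ, hf]
    rfl

/-- A lifting of a separable finitely generated extension to a Henselian local ring. -/
theorem exists_lift_of_macLaneSeparable [HenselianLocalRing A] (p : ℕ) (hp : p.Prime)
    {K L : Type*} [Field K] [CharP K p] [Field L] [Algebra K L] [Algebra.EssFiniteType K L]
    (hKL : MacLaneSeparable p (algebraMap K L)) (ψ : K →+* A) (ι : L →+* ResidueField A)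
    (h : (residue A).comp ψ = ι.comp (algebraMap K L)) :
    ∃ φ : L →+* A, φ.comp (algebraMap K L) = ψ ∧ (residue A).comp φ = ι := by
  have : ExpChar K p := .prime hp
  obtain ⟨s, hs, hsep⟩ :=
    -- The condition needed is the contrapositive of `MacLaneSeparable`: independent elements have
    -- independent `p`-th powers.
    exists_isTranscendenceBasis_and_isSeparable_of_linearIndepOn_pow_of_essFiniteType
      (k := K) (K := L) p hp fun s hs => by
    let e := s.equivFin
    rw [LinearIndepOn, ← linearIndependent_equiv e.symm, Fintype.linearIndependent_iff] at hs ⊢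
    intro a ha
    by_contra! hne
    obtain ⟨b, hb, hb'⟩ := hKL _ (fun i => ((e.symm i : s) : L))
      ⟨a, fun h0 => by simp [h0] at hne, by simpa [Algebra.smul_def] using ha⟩
    exact hb (funext (hs b (by simpa [Algebra.smul_def] using hb')))
  have hr : (s : Set L) = Set.range ((↑) : s → L) := Subtype.range_coe.symm
  rw [hr] at hsep
  obtain ⟨φ₀, hφ₀, hφ₀'⟩ := exists_lift_adjoin_of_algebraicIndependent ψ ι h hs.1
  have : Algebra.EssFiniteType (IntermediateField.adjoin K (Set.range ((↑) : s → L))) L :=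
    .of_comp K _ L
  have : FiniteDimensional (IntermediateField.adjoin K (Set.range ((↑) : s → L))) L :=
    Algebra.finite_of_essFiniteType_of_isAlgebraic
  obtain ⟨φ, hφ, hφ'⟩ := exists_lift_of_finite_separable φ₀ ι hφ₀'
  refine ⟨φ, ?_, hφ'⟩
  rw [IsScalarTower.algebraMap_eq K (IntermediateField.adjoin K (Set.range ((↑) : s → L))) L,
    ← RingHom.comp_assoc, hφ, hφ₀]

end Lifting

/-! ### Gluing partial liftings in an ultrapower -/

namespace UltraTower

open IsLocalRing Filter

attribute [local instance] isLocalRing_germ isLocalHom_diag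

theorem macLaneSeparable_intermediateField {p : ℕ} {K L : Type*} [Field K] [Field L] [Algebra K L]
    (h : MacLaneSeparable p (algebraMap K L)) (E : IntermediateField K L) :
    MacLaneSeparable p (algebraMap K E) := by
  rintro n x ⟨a, ha, hax⟩
  obtain ⟨b, hb, hbx⟩ := h n (fun i => (x i : L))
    ⟨a, ha, by simpa using congrArg (algebraMap E L) hax⟩
  refine ⟨b, hb, (algebraMap E L).injective ?_⟩
  simpa using hbx

/-- Liftings on the finitely generated subfields of the residue field, amalgamated along an
ultrafilter, give a lifting on the residue field with values in the ultrapower. -/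
theorem exists_lift_ultrapower {A : Type u} [CommRing A] [HenselianLocalRing A] (p : ℕ)
    [Fact p.Prime] {K : Type*} [Field K] [CharP K p] (t : K →+* A)
    (hsep : MacLaneSeparable p ((residue A).comp t)) {I : Type u} (𝒰 : Ultrafilter I)
    (g : I → Finset A) (hg : Tendsto g 𝒰 atTop) :
    ∃ t' : ResidueField A →+* (𝒰 : Filter I).Germ A,
      t'.comp ((residue A).comp t) = (diag 𝒰 A).comp t ∧
      (residue _).comp t' = ResidueField.map (diag 𝒰 A) := by
  classical
  let : Algebra K (ResidueField A) := ((residue A).comp t).toAlgebra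
  let E (s : Finset A) : IntermediateField K (ResidueField A) :=
    IntermediateField.adjoin K (residue A '' s)
  have hE (s : Finset A) : Algebra.EssFiniteType K (E s) := by
    rw [IntermediateField.essFiniteType_iff]
    exact IntermediateField.fg_adjoin_of_finite (s.finite_toSet.image _)
  choose φ hφt hφ using fun s => exists_lift_of_macLaneSeparable p Fact.out
    (macLaneSeparable_intermediateField hsep (E s)) t (algebraMap (E s) (ResidueField A)) rfl
  -- Because `g` tends to `atTop`, almost every `g i` contains a given representative of `x`.
  have hev (x : ResidueField A) : ∀ᶠ i in (𝒰 : Filter I), x ∈ E (g i) := by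
    obtain ⟨a, rfl⟩ := residue_surjective x
    filter_upwards [hg (Ici_mem_atTop {a})] with i hi
    exact IntermediateField.subset_adjoin _ _ ⟨a, by simpa using hi, rfl⟩
  let c (x : ResidueField A) (i : I) : A := if h : x ∈ E (g i) then φ (g i) ⟨x, h⟩ else 0
  have hc {x : ResidueField A} {i : I} (h : x ∈ E (g i)) : c x i = φ (g i) ⟨x, h⟩ := dif_pos h
  let t' : ResidueField A →+* (𝒰 : Filter I).Germ A :=
    { toFun := fun x => (c x : (𝒰 : Filter I).Germ A)
      map_one' := Germ.coe_eq.2 ((hev 1).mono fun i hi => (hc hi).trans (map_one (φ (g i))))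
      map_zero' := Germ.coe_eq.2 ((hev 0).mono fun i hi => (hc hi).trans (map_zero (φ (g i))))
      map_mul' := fun x y => Germ.coe_eq.2 <| by
        filter_upwards [hev x, hev y] with i hx hy
        change c (x * y) i = c x i * c y i
        rw [hc hx, hc hy, hc (mul_mem hx hy), ← map_mul]
        rfl
      map_add' := fun x y => Germ.coe_eq.2 <| by
        filter_upwards [hev x, hev y] with i hx hy
        change c (x + y) i = c x i + c y i
        rw [hc hx, hc hy, hc (add_mem hx hy), ← map_add]
        rfl }
  refine ⟨t', RingHom.ext fun a => Germ.coe_eq.2 (Eventually.of_forall fun i => ?_),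
    RingHom.ext fun x => ?_⟩
  · exact (hc ((E (g i)).algebraMap_mem a)).trans (RingHom.congr_fun (hφt (g i)) a)
  · obtain ⟨a, rfl⟩ := residue_surjective x
    change germResidue 𝒰 A (c (residue A a)) = germResidue 𝒰 A (fun _ => a)
    rw [← sub_eq_zero, ← map_sub, germResidue_eq_zero_iff]
    filter_upwards [hev (residue A a)] with i hi
    rw [Pi.sub_apply, map_sub, sub_eq_zero, hc hi]
    exact RingHom.congr_fun (hφ (g i)) _

/-- The underlying types of the tower in which each stage is an ultrapower indexed by the finite
subsets of the preceding stage. -/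
def finsetTower (V : Type u) : ℕ → Type u
  | 0 => V
  | n + 1 =>
    Filter.Germ ((Ultrafilter.of atTop : Ultrafilter (Finset (finsetTower V n))) :
      Filter (Finset (finsetTower V n))) (finsetTower V n)

/-- Each index set consists of the finite subsets of the preceding stage, which itself depends on
the earlier ultrafilters. `finsetTower` breaks this circularity by building the types first; the two
towers are then identified by induction. -/
theorem exists_ultrafilters_tendsto_finset (V : Type u) :
    ∃ (U : ℕ → Type u) (𝒰 : ∀ n, Ultrafilter (U n)),
      ∀ n, ∃ g : U n → Finset (UltraTower V 𝒰 n), Tendsto g (𝒰 n) atTop := by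
  let 𝒰 (n : ℕ) : Ultrafilter (Finset (finsetTower V n)) := Ultrafilter.of atTop
  have h (n : ℕ) : UltraTower V 𝒰 n = finsetTower V n := by
    induction n with
    | zero => rfl
    | succ n ih => exact congrArg (fun X => (𝒰 n : Filter (Finset (finsetTower V n))).Germ X) ih
  refine ⟨_, 𝒰, fun n => ?_⟩
  rw [h n]
  exact ⟨id, Ultrafilter.of_le atTop⟩

theorem isLocalHom_succMap (V : Type u) [CommRing V] {U : ℕ → Type u}
    (𝒰 : ∀ n, Ultrafilter (U n)) (n : ℕ) : IsLocalHom (succMap V 𝒰 n) :=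
  isLocalHom_diag (𝒰 n)

theorem henselianLocalRing (V : Type u) [CommRing V] {U : ℕ → Type u}
    (𝒰 : ∀ n, Ultrafilter (U n)) [HenselianLocalRing V] :
    ∀ n, HenselianLocalRing (UltraTower V 𝒰 n)
  | 0 => inferInstanceAs (HenselianLocalRing V)
  | n + 1 =>
    haveI := henselianLocalRing V 𝒰 n
    henselianLocalRing_germ (𝒰 := 𝒰 n) (A := UltraTower V 𝒰 n)

/-! ### Maps out of the direct limit -/

section Limit

variable {V : Type u} [CommRing V] {U : ℕ → Type u} {𝒰 : ∀ n, Ultrafilter (U n)}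

/-- The structure map `V_n → Ṽ` of the direct limit. -/
noncomputable abbrev toLimit (n : ℕ) : UltraTower V 𝒰 n →+* Limit V 𝒰 :=
  DirectLimit.Ring.of (UltraTower V 𝒰) (map V 𝒰) n

theorem toLimit_succMap (n : ℕ) (x : UltraTower V 𝒰 n) :
    toLimit (n + 1) (succMap V 𝒰 n x) = toLimit n x := by
  have := DirectLimit.Ring.of_f (f := map V 𝒰) n.le_succ x
  rwa [map_succ V 𝒰 n n le_rfl, map_self] at this

theorem exists_eq_toLimit (z : Limit V 𝒰) : ∃ n x, z = toLimit n x :=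
  DirectLimit.exists_eq_mk (map V 𝒰) z

/-- A family of homomorphisms from the stages which is compatible with the diagonal embeddings
induces a homomorphism from the limit. -/
theorem exists_limit_ringHom {R : Type*} [CommRing R] (T : ∀ n, UltraTower V 𝒰 n →+* R)
    (hT : ∀ n x, T (n + 1) (succMap V 𝒰 n x) = T n x) :
    ∃ S : Limit V 𝒰 →+* R, ∀ n x, S (toLimit n x) = T n x := by
  have hTmap (i j : ℕ) (h : i ≤ j) (x) : T j (map V 𝒰 i j h x) = T i x := by
    induction h with
    | refl => rw [map_self, RingHom.id_apply]
    | step h ih => rw [map_succ V 𝒰 _ _ h, RingHom.comp_apply, hT, ih]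
  exact ⟨DirectLimit.Ring.lift _ (map V 𝒰) _ T hTmap, fun n x => rfl⟩

end Limit

/-- An idempotent endomorphism of a local ring which kills the maximal ideal induces a lifting of
the residue field. -/
theorem exists_isResidueFieldLifting_of_idempotent {R : Type*} [CommRing R] [IsLocalRing R]
    (T : R →+* R) (hT : ∀ z ∈ maximalIdeal R, T z = 0) (hTT : ∀ z, T (T z) = T z) :
    ∃ t : ResidueField R →+* R, IsResidueFieldLifting t := by
  refine ⟨Ideal.Quotient.lift (maximalIdeal R) T hT, RingHom.ext fun z => ?_⟩
  obtain ⟨z, rfl⟩ := residue_surjective z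
  change residue R (T z) = residue R z
  rw [← sub_eq_zero, ← map_sub, residue_eq_zero_iff]
  -- If `T z - z` were a unit, so would be its image under `T`, which is 0 by idempotence.
  intro hu
  have h := hu.map T
  rw [map_sub, hTT, sub_self] at h
  exact not_isUnit_zero h

/-! ### Compatible liftings along the tower -/

section Tower

variable (V : Type u) [CommRing V] [IsDomain V] [ValuationRing V] {U : ℕ → Type u}
  (𝒰 : ∀ n, Ultrafilter (U n))

attribute [local instance] isLocalHom_succMap henselianLocalRing

theorem charP_residueField (p : ℕ) [CharP (ResidueField V) p] :
    ∀ n, CharP (ResidueField (UltraTower V 𝒰 n)) p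
  | 0 => inferInstanceAs (CharP (ResidueField V) p)
  | n + 1 =>
    haveI := charP_residueField p n
    charP_of_injective_ringHom (ResidueField.map (succMap V 𝒰 n)).injective p

/-- A homomorphism `k_n → V_{n+1}` which lifts the map of residue fields `k_n → k_{n+1}` induced
by the diagonal embedding. -/
abbrev StageLifting (n : ℕ) : Type u :=
  {t : ResidueField (UltraTower V 𝒰 n) →+* UltraTower V 𝒰 (n + 1) //
    (residue _).comp t = ResidueField.map (succMap V 𝒰 n)}

variable {V 𝒰}

/-- Compatible liftings of the stages induce a lifting of the residue field of the limit. -/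
theorem exists_isResidueFieldLifting_limit (t : ∀ n, StageLifting V 𝒰 n)
    (ht : ∀ n, (t (n + 1)).1.comp (ResidueField.map (succMap V 𝒰 n)) =
      (succMap V 𝒰 (n + 1)).comp (t n).1) :
    ∃ t : ResidueField (Limit V 𝒰) →+* Limit V 𝒰, IsResidueFieldLifting t := by
  have ht' (n) (x : ResidueField (UltraTower V 𝒰 n)) :
      toLimit (n + 2) ((t (n + 1)).1 (ResidueField.map (succMap V 𝒰 n) x)) =
        toLimit (n + 1) ((t n).1 x) := by
    rw [← toLimit_succMap (n + 1)]
    exact congrArg (toLimit (n + 2)) (RingHom.congr_fun (ht n) x)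
  -- On `V_n`, `T` is reduction to `k_n` followed by `t_n` and the map to the limit; compatibility
  -- of the `t_n` makes these agree.
  obtain ⟨T, hT⟩ := exists_limit_ringHom
    (fun n => (toLimit (n + 1)).comp ((t n).1.comp (residue (UltraTower V 𝒰 n))))
    (fun n x => ht' n (residue _ x))
  refine exists_isResidueFieldLifting_of_idempotent T (fun z hz => ?_) fun z => ?_
  · obtain ⟨n, x, rfl⟩ := exists_eq_toLimit z
    have hx : residue _ x = 0 :=
      (residue_eq_zero_iff x).2 fun hx => hz (hx.map (toLimit n))
    rw [hT, RingHom.comp_apply, RingHom.comp_apply, hx, map_zero, map_zero]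
  · obtain ⟨n, x, rfl⟩ := exists_eq_toLimit z
    rw [hT, RingHom.comp_apply, RingHom.comp_apply, hT, RingHom.comp_apply, RingHom.comp_apply]
    -- The outer `T` acts at stage `n + 1`, where the residue of `t_n` is the diagonal map `k_n →
    -- k_{n+1}`; rewriting the right side as a value of `t_{n+1}` reduces idempotence to this fact.
    rw [← ht' n]
    exact congrArg (fun y => toLimit (n + 2) ((t (n + 1)).1 y))
      (RingHom.congr_fun (t n).2 (residue _ x))

variable [HenselianLocalRing V] (p : ℕ) [Fact p.Prime]

theorem exists_stageLifting_zero [CharP V p] [CharP (ResidueField V) p]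
    {g : U 0 → Finset (UltraTower V 𝒰 0)}
    (hg : Tendsto g (𝒰 0) atTop) : Nonempty (StageLifting V 𝒰 0) := by
  have : CharP (UltraTower V 𝒰 0) p := inferInstanceAs (CharP V p)
  have := charP_residueField V 𝒰 p 0
  obtain ⟨t, -, ht⟩ := exists_lift_ultrapower p (ZMod.castHom dvd_rfl (UltraTower V 𝒰 0))
    (MacLaneSeparable.of_zmod p _) (𝒰 0) g hg
  exact ⟨t, ht⟩

/-- Here `t_n` serves as the base map `K → A`, with `K = k_n` and `A = V_{n+1}`: it induces the
diagonal extension `k_n → k_{n+1}`, which is separable. -/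
theorem exists_stageLifting_succ [CharP (ResidueField V) p] {n : ℕ} (t : StageLifting V 𝒰 n)
    {g : U (n + 1) → Finset (UltraTower V 𝒰 (n + 1))} (hg : Tendsto g (𝒰 (n + 1)) atTop) :
    ∃ t' : StageLifting V 𝒰 (n + 1),
      t'.1.comp (ResidueField.map (succMap V 𝒰 n)) = (succMap V 𝒰 (n + 1)).comp t.1 := by
  have := charP_residueField V 𝒰 p n
  have hsep : MacLaneSeparable p ((residue _).comp t.1) := by
    rw [t.2]
    exact macLaneSeparable_residueField_map_diag (𝒰 n) (UltraTower V 𝒰 n) p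
  obtain ⟨t', ht', h⟩ := exists_lift_ultrapower p t.1 hsep (𝒰 (n + 1)) g hg
  rw [t.2] at ht'
  exact ⟨⟨t', h⟩, ht'⟩

theorem exists_compatible_stageLiftings [CharP V p] [CharP (ResidueField V) p]
    (hg : ∀ n, ∃ g : U n → Finset (UltraTower V 𝒰 n), Tendsto g (𝒰 n) atTop) :
    ∃ t : ∀ n, StageLifting V 𝒰 n, ∀ n,
      (t (n + 1)).1.comp (ResidueField.map (succMap V 𝒰 n)) =
        (succMap V 𝒰 (n + 1)).comp (t n).1 := by
  choose g hg using hg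
  obtain ⟨t₀⟩ := exists_stageLifting_zero p (hg 0)
  choose s hs using fun n (t : StageLifting V 𝒰 n) => exists_stageLifting_succ p t (hg (n + 1))
  exact ⟨fun n => Nat.rec t₀ s n, fun n => hs n _⟩

end Tower

end UltraTower

theorem theorem3p4 (p : ℕ) [Fact p.Prime] (V : Type u) [CommRing V] [IsDomain V] [ValuationRing V]
    [HenselianLocalRing V] [CharP V p] [CharP (IsLocalRing.ResidueField V) p] :
    ∃ (U : ℕ → Type u) (𝒰 : ∀ n, Ultrafilter (U n)),
      (∀ n, ValuationRing (UltraTower V 𝒰 n)) ∧ ValuationRing (UltraTower.Limit V 𝒰) ∧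
      ∃ t : IsLocalRing.ResidueField (UltraTower.Limit V 𝒰) →+* UltraTower.Limit V 𝒰,
        IsResidueFieldLifting t := by
  obtain ⟨U, 𝒰, hg⟩ := UltraTower.exists_ultrafilters_tendsto_finset V
  obtain ⟨t, ht⟩ := UltraTower.exists_compatible_stageLiftings p hg
  exact ⟨U, 𝒰, inferInstance, inferInstance, UltraTower.exists_isResidueFieldLifting_limit t ht⟩
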